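/- **Setting.** Let $n\ge 0$, $t_0\in\mathbb R$, let $F:\mathbb R^n\times[t_0,\infty)\rightrightarrows\mathbb R^n$ be a set-valued map, let $D\subseteq\mathbb R^n$ be open and connected, let $J=[t_0,b)$ with $t_0<b\le\infty$, and let $\Omega=D\times J$. A solution of $\dot x\in F(x,t)$ over $I=[t_0,T)$, $t_0<T\le\infty$, is a locally absolutely continuous $x:I\to\mathbb R^n$ with $\dot x(t)\in F(x(t),t)$ for almost all $t\in I$; it is maximal if no solution over an interval $[t_0,T')$ with $T'>T$ extends it. Its first exit time from $D$ is $T_D=\min\big(T,\inf\{t\in I: x(t)\notin D\}\big)$ with $\inf\emptyset=\infty$, and $I_D=[t_0,T_D)$. For locally Lipschitz $f:\Omega\to\mathbb R$, the Clarke gradient $\partial f(x,t)$ at $(x,t)\in\Omega$ is the closed convex hull of the set of all limits $\lim_i\nabla f(z_i)$, where $z_i\to(x,t)$ and each $z_i$ is an interior point of $\Omega$ at which $f$ is differentiable. The function $f$ is called regular if at every interior point $z$ of $\Omega$ and for every $v\in\mathbb R^{n+1}$ the one-sided limit $\lim_{h\downarrow0}\frac{f(z+hv)-f(z)}h$ exists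 and is equal to $\limsup_{y\to z,\,h\downarrow 0}\frac{f(y+hv)-f(y)}h$. Let $\mathcal U=\{U_i\}_{i=1}^\infty$ be a sequence of locally Lipschitz regular functions $\Omega\to\mathbb R$, and for $(x,t)\in\Omega$ put $$\tilde F_{\mathcal U}(x,t)=\bigcap_{i=1}^\infty\big\{q\in F(x,t):\ \exists a\in\mathbb R,\ p^T[q;1]=a\ \ \forall p\in\partial U_i(x,t)\big\}.$$ For locally Lipschitz $V:\Omega\to\mathbb R$, the $\mathcal U$-generalized derivative of $V$ is the extended real number $$\dot{\overline V}_{\mathcal U}(x,t)=\begin{cases}\displaystyle\inf_{p\in\partial V(x,t)}\ \sup_{q\in\tilde F_{\mathcal U}(x,t)}p^T[q;1] & \text{if $V$ is regular},\\[2ex] \displaystyle\sup_{p\in\partial V(x,t)}\ \sup_{q\in\tilde F_{\mathcal U}(x,t)}p^T[q;1]&\text{if $V$ is not regular},\end{cases}$$ and $\dot{\overline V}_{\mathcal U}(x,t)=-\infty$ if $\tilde F_{\mathcal U}(x,t)=\emptyset$. **Theorem (weak chain rule).** Let $V:\Omega\to\mathbb R$ be locally Lipschitz, regular or not, and let $x$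 be a maximal solution of $\dot x\in F(x,t)$ with $(x(t_0),t_0)\in\Omega$. Then for almost all $t\in I_D\cap J$ the derivative $\dot V(x(t),t)$ of $s\mapsto V(x(s),s)$ at $s=t$ exists and $$\dot V(x(t),t)\in\big\{p^T[q;1]:\ p\in\partial V(x(t),t),\ q\in\tilde F_{\mathcal U}(x(t),t)\big\}.$$ Moreover, if $W:\Omega\to\mathbb R$ satisfies $\dot{\overline V}_{\mathcal U}(x,t)\le W(x,t)$ for all $(x,t)\in\Omega$, then $\dot V(x(t),t)\le W(x(t),t)$ for almost all $t\in I_D\cap J$. -/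

import Mathlib

open Set Filter Topology MeasureTheory

noncomputable section

namespace ReducedInclusion

/-- The right-open interval `[a, b)`, where the right end point `b` may be `∞`. -/
def rightOpen (a : ℝ) (b : EReal) : Set ℝ := {t : ℝ | a ≤ t ∧ (t : EReal) < b}

/-! ### Clarke's generalized derivative, regularity, and gradient -/

section Clarke

variable {X : Type*} [NormedAddCommGroup X] [NormedSpace ℝ X]

/-- Clarke's generalized directional derivative
`f°(z; v) = limsup_{y → z, h ↓ 0} (f (y + h v) - f y) / h`.
(The limit superior is that of a bounded function if `f` is Lipschitz near `z`.) -/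
def clarkeDeriv (f : X → ℝ) (z v : X) : ℝ :=
  limsup (fun yh : X × ℝ => (f (yh.1 + yh.2 • v) - f yh.1) / yh.2) (𝓝 z ×ˢ 𝓝[>] (0 : ℝ))

/-- `f` is regular at `z` in the sense of Clarke: for every `v` the one-sided directional
derivative `f'(z; v)` exists and is equal to `f°(z; v)`. -/
def ClarkeRegularAt (f : X → ℝ) (z : X) : Prop :=
  ∀ v : X, Tendsto (fun h : ℝ => (f (z + h • v) - f z) / h) (𝓝[>] (0 : ℝ))
    (𝓝 (clarkeDeriv f z v))

/-- `f` is regular on `Ω`. Regularity is a condition at the interior points of `Ω`, where all the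
directional difference quotients involve values of `f` on `Ω` only. -/
def ClarkeRegularOn (Ω : Set X) (f : X → ℝ) : Prop := ∀ z ∈ interior Ω, ClarkeRegularAt f z

/-- The Clarke gradient `∂f(z)` of `f : Ω → ℝ`: the closed convex hull of all the limits of
gradients `∇f(zᵢ)`, where `zᵢ → z` runs through points at which `f` is differentiable. Gradients
are regarded as linear functionals, so that `pᵀ v` is `p v`. The points `zᵢ` are taken in the
interior of `Ω`, where differentiability of `f` depends on its values on `Ω` only. -/
def clarkeGradient (Ω : Set X) (f : X → ℝ) (z : X) : Set (X →L[ℝ] ℝ) :=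
  closedConvexHull ℝ {L : X →L[ℝ] ℝ | ∃ u : ℕ → X,
    (∀ i, u i ∈ interior Ω ∧ DifferentiableAt ℝ f (u i)) ∧
    Tendsto u atTop (𝓝 z) ∧ Tendsto (fun i => fderiv ℝ f (u i)) atTop (𝓝 L)}

end Clarke

/-! ### Differential inclusions -/

section Inclusion

variable {n : ℕ}

/-- `x` is a solution of `ẋ ∈ F(x, t)` over the interval `[t₀, T)` (of nonzero length): it is
locally absolutely continuous there and `ẋ(t) ∈ F(x(t), t)` for almost all `t` in it. -/
structure IsSolution (F : EuclideanSpace ℝ (Fin n) → ℝ → Set (EuclideanSpace ℝ (Fin n)))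
    (t₀ : ℝ) (T : EReal) (x : ℝ → EuclideanSpace ℝ (Fin n)) : Prop where
  lt : (t₀ : EReal) < T
  absolutelyContinuous : ∀ a ∈ rightOpen t₀ T, ∀ b ∈ rightOpen t₀ T,
    AbsolutelyContinuousOnInterval x a b
  inclusion : ∀ᵐ t : ℝ, t ∈ rightOpen t₀ T → DifferentiableAt ℝ x t ∧ deriv x t ∈ F (x t) t

/-- A solution is maximal if it has no proper right extension that is also a solution. -/
def IsMaximalSolution (F : EuclideanSpace ℝ (Fin n) → ℝ → Set (EuclideanSpace ℝ (Fin n)))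
    (t₀ : ℝ) (T : EReal) (x : ℝ → EuclideanSpace ℝ (Fin n)) : Prop :=
  IsSolution F t₀ T x ∧
    ∀ (T' : EReal) (y : ℝ → EuclideanSpace ℝ (Fin n)),
      T < T' → IsSolution F t₀ T' y → ¬ EqOn x y (rightOpen t₀ T)

/-- The first exit time `T_D = min (sup I, inf {t ∈ I | x(t) ∉ D})` from `D` of a function `x`
on `I = [t₀, T)`, where `inf ∅ = ∞`. -/
def exitTime (D : Set (EuclideanSpace ℝ (Fin n))) (t₀ : ℝ) (T : EReal)
    (x : ℝ → EuclideanSpace ℝ (Fin n)) : EReal :=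
  min T (sInf ((fun t : ℝ => (t : EReal)) '' {t ∈ rightOpen t₀ T | x t ∉ D}))

/-- The reduction
`G_U^H(x, t) = {q ∈ H(x, t) | ∃ a ∈ ℝ, pᵀ [q; 1] = a for all p ∈ ∂U(x, t)}`. -/
def reduction (Ω : Set (EuclideanSpace ℝ (Fin n) × ℝ))
    (H : EuclideanSpace ℝ (Fin n) → ℝ → Set (EuclideanSpace ℝ (Fin n)))
    (U : EuclideanSpace ℝ (Fin n) × ℝ → ℝ) (x : EuclideanSpace ℝ (Fin n)) (t : ℝ) :
    Set (EuclideanSpace ℝ (Fin n)) :=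
  {q ∈ H x t | ∃ a : ℝ, ∀ p ∈ clarkeGradient Ω U (x, t), p (q, 1) = a}

/-- The `𝒰`-reduced differential inclusion `F̃_𝒰(x, t) = ⋂ᵢ G_{Uᵢ}^F(x, t)`. -/
def reducedInclusion (Ω : Set (EuclideanSpace ℝ (Fin n) × ℝ))
    (F : EuclideanSpace ℝ (Fin n) → ℝ → Set (EuclideanSpace ℝ (Fin n)))
    (U : ℕ → EuclideanSpace ℝ (Fin n) × ℝ → ℝ) (x : EuclideanSpace ℝ (Fin n)) (t : ℝ) :
    Set (EuclideanSpace ℝ (Fin n)) :=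
  ⋂ i, reduction Ω F (U i) x t

open Classical in
/-- The `𝒰`-generalized derivative of `V` in the direction(s) `F`, an extended real:
`-∞` where `F̃_𝒰(x, t)` is empty, and otherwise
`min_{p ∈ ∂V(x,t)} max_{q ∈ F̃_𝒰(x,t)} pᵀ [q; 1]` if `V` is regular and
`max_{p ∈ ∂V(x,t)} max_{q ∈ F̃_𝒰(x,t)} pᵀ [q; 1]` if it is not, the extrema being read as
infimum and supremum in `[-∞, ∞]`, which agree with them whenever they are attained. -/
def generalizedDeriv (Ω : Set (EuclideanSpace ℝ (Fin n) × ℝ))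
    (F : EuclideanSpace ℝ (Fin n) → ℝ → Set (EuclideanSpace ℝ (Fin n)))
    (U : ℕ → EuclideanSpace ℝ (Fin n) × ℝ → ℝ) (V : EuclideanSpace ℝ (Fin n) × ℝ → ℝ)
    (x : EuclideanSpace ℝ (Fin n)) (t : ℝ) : EReal :=
  if reducedInclusion Ω F U x t = ∅ then ⊥
  else if ClarkeRegularOn Ω V then
    ⨅ p ∈ clarkeGradient Ω V (x, t), ⨆ q ∈ reducedInclusion Ω F U x t, ((p (q, 1) : ℝ) : EReal)
  else
    ⨆ p ∈ clarkeGradient Ω V (x, t), ⨆ q ∈ reducedInclusion Ω F U x t, ((p (q, 1) : ℝ) : EReal)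

end Inclusion

end ReducedInclusion

end

noncomputable section

namespace ReducedInclusion

open scoped NNReal

/-! Along a solution `x`, a locally Lipschitz `f` is locally a Lipschitz function of an absolutely
continuous curve, hence differentiable at almost every time. At such a time, if `x` is
differentiable too, the curve `(x s, s)` may be replaced by its tangent line, so `f` has a two-sided
directional derivative `d` in the direction `v = (ẋ, 1)`. For regular `f`, the bound `p v ≤ f°(z;
v)` applied to `v` and `-v` forces `p v = d` for every `p` in the Clarke gradient
(`ClarkeRegularAt.apply_eq`). Applied to all the `U i`, this puts `ẋ` in the reduced inclusion. For
arbitrary `V`, Rademacher and Fubini still give one `p` with `p v = d`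
(`exists_mem_clarkeGradient_eq`), which is the chain rule. -/

/-- A locally Lipschitz function agrees near each interior point of its domain with a function
that is Lipschitz on the whole space. -/
theorem exists_lipschitzWith_eventuallyEq {X : Type*} [PseudoMetricSpace X] {Ω : Set X}
    {f : X → ℝ} (hf : LocallyLipschitzOn Ω f) {z : X} (hz : z ∈ interior Ω) :
    ∃ (K : ℝ≥0) (g : X → ℝ), LipschitzWith K g ∧ f =ᶠ[𝓝 z] g := by
  obtain ⟨K, s, hs, hK⟩ := hf (interior_subset hz)
  rw [nhdsWithin_eq_nhds.2 (mem_interior_iff_mem_nhds.1 hz)] at hs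
  obtain ⟨g, hg, hfg⟩ := hK.extend_real
  exact ⟨K, g, hg, eventually_of_mem hs hfg⟩

/-- A Lipschitz function of an absolutely continuous curve and of time is absolutely continuous. -/
theorem absolutelyContinuousOnInterval_comp_prodMk {X Y : Type*} [PseudoMetricSpace X]
    [PseudoMetricSpace Y] {K : ℝ≥0} {g : X × ℝ → Y} (hg : LipschitzWith K g)
    {x : ℝ → X} {a b : ℝ} (hx : AbsolutelyContinuousOnInterval x a b) :
    AbsolutelyContinuousOnInterval (fun s => g (x s, s)) a b := by
  have hid : AbsolutelyContinuousOnInterval (fun s : ℝ => s) a b :=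
    (LipschitzWith.id.lipschitzOnWith (s := uIcc a b)).absolutelyContinuousOnInterval
  have hsum := (Tendsto.add hx hid).const_mul (K : ℝ)
  rw [add_zero, mul_zero] at hsum
  refine squeeze_zero (fun E => Finset.sum_nonneg fun i _ => dist_nonneg) (fun E => ?_) hsum
  rw [← Finset.sum_add_distrib, Finset.mul_sum]
  refine Finset.sum_le_sum fun i _ => (hg.dist_le_mul _ _).trans ?_
  refine mul_le_mul_of_nonneg_left ?_ K.2
  rw [Prod.dist_eq]
  exact max_le_add_of_nonneg dist_nonneg dist_nonneg

/-! ### Directional derivatives and Clarke gradients. -/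

section Clarke

variable {X : Type*} [NormedAddCommGroup X] [NormedSpace ℝ X]

/-- A Lipschitz function that is differentiable along a curve has the same derivative along the
tangent line to the curve. -/
theorem hasDerivAt_along_tangent {K : ℝ≥0} {g : X → ℝ} (hg : LipschitzWith K g) {γ : ℝ → X}
    {t d : ℝ} {v : X} (hγ : HasDerivAt γ v t) (hd : HasDerivAt (fun s => g (γ s)) d t) :
    HasDerivAt (fun h : ℝ => g (γ t + h • v)) d 0 := by
  have hline : HasDerivAt (fun s : ℝ => g (γ t + (s - t) • v)) d t := by
    rw [hasDerivAt_iff_isLittleO] at hγ hd ⊢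
    -- Moving from the curve to its tangent costs at most `K` times the first-order remainder of
    -- `γ`, which is `o(s - t)`.
    have hO : (fun s => g (γ t + (s - t) • v) - g (γ s)) =O[𝓝 t]
        fun s => γ s - γ t - (s - t) • v := by
      refine Asymptotics.IsBigO.of_bound K (Eventually.of_forall fun s => ?_)
      rw [← dist_eq_norm, dist_comm]
      refine (hg.dist_le_mul _ _).trans (le_of_eq ?_)
      rw [dist_eq_norm, sub_sub]
    refine ((hO.trans_isLittleO hγ).add hd).congr_left fun s => ?_
    simp only [smul_eq_mul, sub_self, zero_smul, add_zero]
    ring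
  have := HasDerivAt.comp_const_add (f := fun s : ℝ => g (γ t + (s - t) • v)) t 0
    (by simpa using hline)
  simpa using this

theorem tendsto_quotient_of_hasDerivAt {g : X → ℝ} {z v : X} {d : ℝ}
    (h : HasDerivAt (fun h : ℝ => g (z + h • v)) d 0) :
    Tendsto (fun h : ℝ => (g (z + h • v) - g z) / h) (𝓝[>] (0 : ℝ)) (𝓝 d) := by
  have := h.tendsto_slope.mono_left (nhdsWithin_mono (0 : ℝ) fun y (hy : 0 < y) => hy.ne')
  refine this.congr fun y => ?_
  simp [slope_def_field]

theorem hasDerivAt_along_neg {g : X → ℝ} {z v : X} {d : ℝ}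
    (h : HasDerivAt (fun h : ℝ => g (z + h • v)) d 0) :
    HasDerivAt (fun h : ℝ => g (z + h • (-v))) (-d) 0 := by
  have := HasDerivAt.comp_const_sub (f := fun h : ℝ => g (z + h • v)) 0 0 (by simpa using h)
  simpa using this

/-- If the derivatives of a Lipschitz function along a segment are almost everywhere at most `c`,
then so is its difference quotient. -/
theorem sub_le_of_ae_deriv_le {K : ℝ≥0} {φ : ℝ → ℝ} (hφ : LipschitzWith K φ) {c h : ℝ}
    (hh : 0 ≤ h) (hc : ∀ᵐ τ : ℝ, τ ∈ Icc 0 h → deriv φ τ ≤ c) : φ h - φ 0 ≤ h * c := by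
  have hac : AbsolutelyContinuousOnInterval φ 0 h :=
    (hφ.lipschitzOnWith (s := uIcc 0 h)).absolutelyContinuousOnInterval
  rw [← hac.integral_deriv_eq_sub]
  have := intervalIntegral.integral_mono_ae_restrict hh hac.intervalIntegrable_deriv
    (intervalIntegrable_const (c := c) (μ := volume))
    ((ae_restrict_iff' measurableSet_Icc).2 hc)
  simpa using this

/-- Near `z` there are points of differentiability of a Lipschitz function whose derivative in the
direction `v` is almost as large as the directional derivative at `z`. -/
theorem exists_differentiableAt_lt_fderiv [FiniteDimensional ℝ X] {K : ℝ≥0} {g : X → ℝ}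
    (hg : LipschitzWith K g) {z v : X} {c d : ℝ}
    (hd : Tendsto (fun h : ℝ => (g (z + h • v) - g z) / h) (𝓝[>] (0 : ℝ)) (𝓝 d)) (hc : c < d)
    {s : Set X} (hs : s ∈ 𝓝 z) :
    ∃ y ∈ s, DifferentiableAt ℝ g y ∧ c < fderiv ℝ g y v := by
  borelize X
  by_contra! hcon
  -- The segment from `z` itself may miss every point of differentiability; by Rademacher and Fubini
  -- almost every parallel line meets them almost everywhere.
  have hae : ∀ᵐ y ∂(Measure.addHaar : Measure X), ∀ᵐ τ : ℝ,
      DifferentiableAt ℝ g (y + τ • v) := by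
    have := (ae_ae_add_linearMap_mem_iff (LinearMap.toSpanSingleton ℝ X v) volume
      (Measure.addHaar : Measure X) (measurableSet_of_differentiableAt ℝ g)).2
      hg.ae_differentiableAt
    simpa using this
  obtain ⟨r, hr, hrs⟩ := Metric.mem_nhds_iff.1 hs
  have hsmall : ∀ᶠ h : ℝ in 𝓝[>] 0, h * ‖v‖ < r / 2 := by
    have : Tendsto (fun h : ℝ => h * ‖v‖) (𝓝[>] 0) (𝓝 (0 * ‖v‖)) :=
      (tendsto_id.mul_const _).mono_left nhdsWithin_le_nhds
    rw [zero_mul] at this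
    exact this.eventually_lt_const (by positivity)
  obtain ⟨h, ⟨hch, hhr⟩, hh⟩ :=
    (((hd.eventually_const_lt hc).and hsmall).and self_mem_nhdsWithin).exists
  replace hh : 0 < h := hh
  rw [lt_div_iff₀ hh] at hch
  have hcont : Continuous fun y => g (y + h • v) - g y := by
    have := hg.continuous
    fun_prop
  -- With `h` fixed, the strict inequality is open in the base point, so it survives a move from `z`
  -- to a good line.
  have hU : {y | c * h < g (y + h • v) - g y} ∩ Metric.ball z (r / 2) ∈ 𝓝 z :=
    inter_mem (hcont.continuousAt.eventually_const_lt hch) (Metric.ball_mem_nhds _ (by positivity))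
  obtain ⟨y, hy, hyc, hyr⟩ := (Measure.dense_of_ae hae).inter_nhds_nonempty hU
  have hφ : LipschitzWith (K * ‖v‖₊) fun τ : ℝ => g (y + τ • v) :=
    hg.comp (LipschitzWith.of_dist_le_mul fun a b => by
      simp [dist_eq_norm, ← sub_smul, norm_smul, mul_comm])
  have := sub_le_of_ae_deriv_le hφ hh.le (c := c) (by
    filter_upwards [hy] with τ hτ hτh
    have hder : HasDerivAt (fun τ : ℝ => g (y + τ • v)) (fderiv ℝ g (y + τ • v) v) τ := by
      have hl : HasDerivAt (fun τ : ℝ => y + τ • v) v τ := by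
        simpa using ((hasDerivAt_id τ).smul_const v).const_add y
      exact hτ.hasFDerivAt.comp_hasDerivAt τ hl
    rw [hder.deriv]
    refine hcon _ (hrs ?_) hτ
    rw [mem_ball_iff_norm] at hyr ⊢
    calc ‖y + τ • v - z‖ = ‖(y - z) + τ • v‖ := by congr 1; abel
      _ ≤ ‖y - z‖ + ‖τ • v‖ := norm_add_le _ _
      _ = ‖y - z‖ + τ * ‖v‖ := by rw [norm_smul, Real.norm_of_nonneg hτh.1]
      _ ≤ ‖y - z‖ + h * ‖v‖ := by gcongr; exact hτh.2
      _ < r := by linarith)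
  simp only [zero_smul, add_zero] at this
  have hyc' : c * h < g (y + h • v) - g y := hyc
  linarith

theorem convex_clarkeGradient (Ω : Set X) (f : X → ℝ) (z : X) :
    Convex ℝ (clarkeGradient Ω f z) :=
  convex_closedConvexHull

/-- Some Clarke gradient at `z` dominates the directional derivative of `f` at `z`. -/
theorem exists_mem_clarkeGradient_le [FiniteDimensional ℝ X] {Ω : Set X} {f : X → ℝ}
    (hf : LocallyLipschitzOn Ω f) {z v : X} (hz : z ∈ interior Ω) {d : ℝ}
    (hd : Tendsto (fun h : ℝ => (f (z + h • v) - f z) / h) (𝓝[>] (0 : ℝ)) (𝓝 d)) :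
    ∃ p ∈ clarkeGradient Ω f z, d ≤ p v := by
  obtain ⟨K, g, hg, hfg⟩ := exists_lipschitzWith_eventuallyEq hf hz
  have hline : Tendsto (fun h : ℝ => z + h • v) (𝓝[>] 0) (𝓝 z) := by
    have : ContinuousAt (fun h : ℝ => z + h • v) 0 := by fun_prop
    simpa [ContinuousAt] using this.tendsto.mono_left nhdsWithin_le_nhds
  have hdg : Tendsto (fun h : ℝ => (g (z + h • v) - g z) / h) (𝓝[>] (0 : ℝ)) (𝓝 d) := by
    refine hd.congr' ?_
    filter_upwards [hline.eventually hfg] with h hh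
    rw [hh, hfg.eq_of_nhds]
  have hW : {y | f =ᶠ[𝓝 y] g} ∩ interior Ω ∈ 𝓝 z :=
    inter_mem hfg.eventuallyEq_nhds (isOpen_interior.mem_nhds hz)
  have hpos : ∀ i : ℕ, (0 : ℝ) < 1 / ((i : ℝ) + 1) := fun i => Nat.one_div_pos_of_nat
  choose u hus hud hulim using fun i : ℕ =>
    exists_differentiableAt_lt_fderiv hg hdg (sub_lt_self d (hpos i))
      (inter_mem hW (Metric.ball_mem_nhds z (hpos i)))
  have hutend : Tendsto u atTop (𝓝 z) := by
    rw [tendsto_iff_dist_tendsto_zero]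
    exact squeeze_zero (fun _ => dist_nonneg) (fun i => (hus i).2.le)
      tendsto_one_div_add_atTop_nhds_zero_nat
  have : ProperSpace (X →L[ℝ] ℝ) := FiniteDimensional.proper ℝ _
  -- All gradients of `g` have norm at most `K`, so a subsequence converges.
  obtain ⟨L, -, φ, hφ, hL⟩ := (isCompact_closedBall (0 : X →L[ℝ] ℝ) K).tendsto_subseq
    (x := fun i => fderiv ℝ g (u i)) fun i => by
      simpa using norm_fderiv_le_of_lipschitz ℝ hg
  refine ⟨L, subset_closedConvexHull ⟨u ∘ φ, fun i => ⟨(hus _).1.2, ?_⟩,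
    hutend.comp hφ.tendsto_atTop, ?_⟩, ?_⟩
  · exact (hus (φ i)).1.1.differentiableAt_iff.2 (hud _)
  · exact hL.congr fun i => ((hus (φ i)).1.1.fderiv_eq).symm
  · have h1 : Tendsto (fun i => fderiv ℝ g (u (φ i)) v) atTop (𝓝 (L v)) :=
      ((ContinuousLinearMap.apply ℝ ℝ v).continuous.tendsto L).comp hL
    have h2 : Tendsto (fun i : ℕ => d - 1 / ((φ i : ℝ) + 1)) atTop (𝓝 d) := by
      simpa using (tendsto_one_div_add_atTop_nhds_zero_nat.comp hφ.tendsto_atTop).const_sub d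
    exact le_of_tendsto_of_tendsto' h2 h1 fun i => (hulim (φ i)).le

/-- A two-sided directional derivative is attained by some Clarke gradient. -/
theorem exists_mem_clarkeGradient_eq [FiniteDimensional ℝ X] {Ω : Set X} {f : X → ℝ}
    (hf : LocallyLipschitzOn Ω f) {z v : X} (hz : z ∈ interior Ω) {d : ℝ}
    (hd : HasDerivAt (fun h : ℝ => f (z + h • v)) d 0) :
    ∃ p ∈ clarkeGradient Ω f z, p v = d := by
  obtain ⟨p, hp, hpd⟩ := exists_mem_clarkeGradient_le hf hz (tendsto_quotient_of_hasDerivAt hd)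
  obtain ⟨q, hq, hqd⟩ := exists_mem_clarkeGradient_le hf hz
    (tendsto_quotient_of_hasDerivAt (hasDerivAt_along_neg hd))
  -- Directions `v` and `-v` yield `q v ≤ d ≤ p v`; the values at `v` of a convex set of functionals
  -- form an interval.
  have hconv := (convex_clarkeGradient Ω f z).linear_image
    (ContinuousLinearMap.apply ℝ ℝ v : (X →L[ℝ] ℝ) →L[ℝ] ℝ).toLinearMap
  refine hconv.ordConnected.out ⟨q, hq, rfl⟩ ⟨p, hp, rfl⟩ ⟨?_, hpd⟩
  have : q (-v) = -q v := map_neg q v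
  change q v ≤ d
  linarith

/-- Clarke gradients are dominated by Clarke's generalized directional derivative. -/
theorem apply_le_clarkeDeriv {Ω : Set X} {f : X → ℝ} (hf : LocallyLipschitzOn Ω f) {z : X}
    (hz : z ∈ interior Ω) (v : X) {p : X →L[ℝ] ℝ} (hp : p ∈ clarkeGradient Ω f z) :
    p v ≤ clarkeDeriv f z v := by
  obtain ⟨K, g, hg, hfg⟩ := exists_lipschitzWith_eventuallyEq hf hz
  have hline : Tendsto (fun yh : X × ℝ => yh.1 + yh.2 • v) (𝓝 z ×ˢ 𝓝[>] (0 : ℝ)) (𝓝 z) := by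
    have : ContinuousAt (fun yh : X × ℝ => yh.1 + yh.2 • v) (z, 0) := by fun_prop
    have h := this.tendsto
    rw [nhds_prod_eq] at h
    simpa using h.mono_left (Filter.prod_mono le_rfl nhdsWithin_le_nhds)
  -- A real `limsup` is meaningful only for a bounded family.
  have hbdd : (𝓝 z ×ˢ 𝓝[>] (0 : ℝ)).IsBoundedUnder (· ≤ ·)
      fun yh : X × ℝ => (f (yh.1 + yh.2 • v) - f yh.1) / yh.2 := by
    refine isBoundedUnder_of_eventually_le (a := K * ‖v‖) ?_
    filter_upwards [hline.eventually hfg, tendsto_fst.eventually hfg,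
      tendsto_snd.eventually self_mem_nhdsWithin] with yh h1 h2 (h3 : 0 < yh.2)
    rw [h1, h2, div_le_iff₀ h3]
    have := (le_abs_self _).trans (hg.dist_le_mul (yh.1 + yh.2 • v) yh.1)
    simpa [dist_eq_norm, norm_smul, abs_of_pos h3, mul_assoc, mul_comm, mul_left_comm] using this
  have hclosed : IsClosed {q : X →L[ℝ] ℝ | q v ≤ clarkeDeriv f z v} :=
    isClosed_le (ContinuousLinearMap.apply ℝ ℝ v).continuous continuous_const
  have hconv : Convex ℝ {q : X →L[ℝ] ℝ | q v ≤ clarkeDeriv f z v} :=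
    convex_halfSpace_le (ContinuousLinearMap.apply ℝ ℝ v).isLinear _
  refine closedConvexHull_min ?_ hconv hclosed hp
  rintro L ⟨u, hu, hutend, hL⟩
  change L v ≤ clarkeDeriv f z v
  refine le_of_forall_lt fun c hc => ?_
  obtain ⟨c', hcc', hc'⟩ := exists_between hc
  refine hcc'.trans_le (le_limsup_of_frequently_le (fun hnot => ?_) hbdd)
  have hLv : Tendsto (fun i => fderiv ℝ f (u i) v) atTop (𝓝 (L v)) :=
    ((ContinuousLinearMap.apply ℝ ℝ v).continuous.tendsto L).comp hL
  obtain ⟨i, hi, hic⟩ :=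
    -- Currying frees the base point from the step: set it to `u i`, then let `h ↓ 0` there, where
    -- the quotients tend to the gradient's value, above `c'`.
    ((hutend.eventually hnot.curry).and (hLv.eventually_const_lt hc')).exists
  have hder : HasDerivAt (fun h : ℝ => f (u i + h • v)) (fderiv ℝ f (u i) v) 0 :=
    (hu i).2.hasFDerivAt.hasLineDerivAt v
  obtain ⟨h, h1, h2⟩ :=
    (hi.and ((tendsto_quotient_of_hasDerivAt hder).eventually_const_lt hic)).exists
  exact h1 h2.le

/-- If a regular function has a two-sided directional derivative, then it is the common value of
all the Clarke gradients in that direction. -/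
theorem ClarkeRegularAt.apply_eq {Ω : Set X} {f : X → ℝ} (hf : LocallyLipschitzOn Ω f)
    {z v : X} (hz : z ∈ interior Ω) (hreg : ClarkeRegularAt f z) {d : ℝ}
    (hd : HasDerivAt (fun h : ℝ => f (z + h • v)) d 0) {p : X →L[ℝ] ℝ}
    (hp : p ∈ clarkeGradient Ω f z) : p v = d := by
  have h1 := tendsto_nhds_unique (hreg v) (tendsto_quotient_of_hasDerivAt hd)
  have h2 := tendsto_nhds_unique (hreg (-v))
    (tendsto_quotient_of_hasDerivAt (hasDerivAt_along_neg hd))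
  have h3 := apply_le_clarkeDeriv hf hz v hp
  have h4 := apply_le_clarkeDeriv hf hz (-v) hp
  rw [map_neg] at h4
  linarith

end Clarke

/-! ### Derivatives along solutions. -/

section Inclusion

variable {n : ℕ}

/-- A locally Lipschitz function is differentiable along a solution at almost all times at which
the solution runs in the interior of its domain. -/
theorem IsSolution.ae_differentiableAt_comp
    {F : EuclideanSpace ℝ (Fin n) → ℝ → Set (EuclideanSpace ℝ (Fin n))} {t₀ : ℝ} {T : EReal}
    {x : ℝ → EuclideanSpace ℝ (Fin n)} (hx : IsSolution F t₀ T x)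
    {Ω : Set (EuclideanSpace ℝ (Fin n) × ℝ)} {f : EuclideanSpace ℝ (Fin n) × ℝ → ℝ}
    (hf : LocallyLipschitzOn Ω f) :
    ∀ᵐ t : ℝ, t₀ < t → (t : EReal) < T → (x t, t) ∈ interior Ω →
      DifferentiableAt ℝ (fun s => f (x s, s)) t := by
  -- The Lipschitz extension `g` exists only near each point, so the exceptional set is shown to be
  -- locally null.
  refine measure_null_of_locally_null _ fun t ht => ?_
  simp only [mem_compl_iff, mem_ofPred_eq, Classical.not_imp] at ht
  obtain ⟨h0, hT, hint, -⟩ := ht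
  obtain ⟨c, htc, hcT⟩ := EReal.lt_iff_exists_real_btwn.1 hT
  have htc' : t < c := EReal.coe_lt_coe_iff.1 htc
  have hac : AbsolutelyContinuousOnInterval x t₀ c :=
    hx.absolutelyContinuous _ ⟨le_rfl, hx.lt⟩ _ ⟨(h0.trans htc').le, hcT⟩
  have hIcc : uIcc t₀ c = Icc t₀ c := uIcc_of_le (h0.trans htc').le
  have hxt : ContinuousOn x (Ioo t₀ c) :=
    hac.continuousOn.mono (hIcc ▸ Ioo_subset_Icc_self)
  have hzt : ContinuousAt (fun s => (x s, s)) t :=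
    (hxt.continuousAt (Ioo_mem_nhds h0 htc')).prodMk continuousAt_id
  obtain ⟨K, g, hg, hfg⟩ := exists_lipschitzWith_eventuallyEq hf hint
  have hnear : {s | f =ᶠ[𝓝 (x s, s)] g} ∩ Ioo t₀ c ∈ 𝓝 t :=
    inter_mem (hzt.eventually hfg.eventuallyEq_nhds) (Ioo_mem_nhds h0 htc')
  refine ⟨_, inter_mem_nhdsWithin _ hnear, ?_⟩
  have hae := (absolutelyContinuousOnInterval_comp_prodMk hg hac).ae_differentiableAt
  refine measure_mono_null ?_ hae
  rintro s ⟨hs, hsfg, hsI⟩ hdiff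
  refine hs fun _ _ _ => ?_
  have hzs : ContinuousAt (fun s => (x s, s)) s :=
    (hxt.continuousAt (Ioo_mem_nhds hsI.1 hsI.2)).prodMk continuousAt_id
  have heq : (fun s => f (x s, s)) =ᶠ[𝓝 s] fun s => g (x s, s) := hzs.eventually hsfg
  exact heq.differentiableAt_iff.2 (hdiff (hIcc ▸ Ioo_subset_Icc_self hsI))

/-- The chain rule along the tangent line for a locally Lipschitz function and a differentiable
curve. -/
theorem hasDerivAt_along_velocity {Ω : Set (EuclideanSpace ℝ (Fin n) × ℝ)}
    {f : EuclideanSpace ℝ (Fin n) × ℝ → ℝ} (hf : LocallyLipschitzOn Ω f)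
    {x : ℝ → EuclideanSpace ℝ (Fin n)} {t : ℝ} (hx : DifferentiableAt ℝ x t)
    (hz : (x t, t) ∈ interior Ω) (hd : DifferentiableAt ℝ (fun s => f (x s, s)) t) :
    HasDerivAt (fun h : ℝ => f ((x t, t) + h • (deriv x t, (1 : ℝ))))
      (deriv (fun s => f (x s, s)) t) 0 := by
  obtain ⟨K, g, hg, hfg⟩ := exists_lipschitzWith_eventuallyEq hf hz
  have hγ : HasDerivAt (fun s => (x s, s)) (deriv x t, (1 : ℝ)) t :=
    hx.hasDerivAt.prodMk (hasDerivAt_id t)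
  have heq : (fun s => f (x s, s)) =ᶠ[𝓝 t] fun s => g (x s, s) :=
    hγ.continuousAt.eventually hfg
  refine (hasDerivAt_along_tangent hg hγ (hd.hasDerivAt.congr_of_eventuallyEq heq.symm)
    ).congr_of_eventuallyEq ?_
  have hcont : ContinuousAt (fun h : ℝ => (x t, t) + h • (deriv x t, (1 : ℝ))) 0 := by fun_prop
  have h0 : (x t, t) + (0 : ℝ) • (deriv x t, (1 : ℝ)) = (x t, t) := by simp
  refine hcont.eventually (p := fun y => f y = g y) ?_
  simpa only [h0, EventuallyEq] using hfg

theorem mem_of_lt_exitTime {D : Set (EuclideanSpace ℝ (Fin n))} {t₀ : ℝ} {T : EReal}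
    {x : ℝ → EuclideanSpace ℝ (Fin n)} {t : ℝ} (ht : t ∈ rightOpen t₀ (exitTime D t₀ T x)) :
    (t : EReal) < T ∧ x t ∈ D := by
  obtain ⟨h0, h1⟩ := ht
  obtain ⟨hT, hinf⟩ := lt_min_iff.1 h1
  refine ⟨hT, by_contra fun hD => ?_⟩
  exact hinf.not_ge (sInf_le ⟨t, ⟨⟨h0, hT⟩, hD⟩, rfl⟩)

theorem mem_interior_prod_rightOpen {D : Set (EuclideanSpace ℝ (Fin n))} (hD : IsOpen D)
    {t₀ : ℝ} {b : EReal} {y : EuclideanSpace ℝ (Fin n)} {t : ℝ} (hy : y ∈ D) (h0 : t₀ < t)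
    (hb : (t : EReal) < b) : (y, t) ∈ interior (D ×ˢ rightOpen t₀ b) := by
  rw [interior_prod_eq, hD.interior_eq]
  refine ⟨hy, mem_interior_iff_mem_nhds.2 ?_⟩
  filter_upwards [lt_mem_nhds h0,
    continuous_coe_real_ereal.continuousAt.eventually_lt_const hb] with s h1 h2
  exact ⟨h1.le, h2⟩

/-- At a time of differentiability the velocity of a curve lies in the reduced inclusion. -/
theorem deriv_mem_reducedInclusion {Ω : Set (EuclideanSpace ℝ (Fin n) × ℝ)}
    {F : EuclideanSpace ℝ (Fin n) → ℝ → Set (EuclideanSpace ℝ (Fin n))}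
    {U : ℕ → EuclideanSpace ℝ (Fin n) × ℝ → ℝ} (hU_lip : ∀ i, LocallyLipschitzOn Ω (U i))
    (hU_reg : ∀ i, ClarkeRegularOn Ω (U i)) {x : ℝ → EuclideanSpace ℝ (Fin n)} {t : ℝ}
    (hz : (x t, t) ∈ interior Ω) (hx : DifferentiableAt ℝ x t) (hF : deriv x t ∈ F (x t) t)
    (hU : ∀ i, DifferentiableAt ℝ (fun s => U i (x s, s)) t) :
    deriv x t ∈ reducedInclusion Ω F U (x t) t :=
  mem_iInter.2 fun i => ⟨hF, _, fun _ hp =>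
    (hU_reg i _ hz).apply_eq (hU_lip i) hz (hasDerivAt_along_velocity (hU_lip i) hx hz (hU i)) hp⟩

/-- If `V` is regular, every `p` takes the same value at the velocity, so even the infimum over `p`
is no obstacle; otherwise a single `p` attaining the derivative suffices for the supremum. -/
theorem deriv_le_generalizedDeriv {Ω : Set (EuclideanSpace ℝ (Fin n) × ℝ)}
    {F : EuclideanSpace ℝ (Fin n) → ℝ → Set (EuclideanSpace ℝ (Fin n))}
    {U : ℕ → EuclideanSpace ℝ (Fin n) × ℝ → ℝ} {V : EuclideanSpace ℝ (Fin n) × ℝ → ℝ}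
    (hV : LocallyLipschitzOn Ω V) {x : ℝ → EuclideanSpace ℝ (Fin n)} {t : ℝ}
    (hz : (x t, t) ∈ interior Ω) (hx : DifferentiableAt ℝ x t)
    (hq : deriv x t ∈ reducedInclusion Ω F U (x t) t)
    (hd : DifferentiableAt ℝ (fun s => V (x s, s)) t) :
    ((deriv (fun s => V (x s, s)) t : ℝ) : EReal) ≤ generalizedDeriv Ω F U V (x t) t := by
  have hline := hasDerivAt_along_velocity hV hx hz hd
  rw [generalizedDeriv, if_neg (Set.nonempty_iff_ne_empty.1 ⟨_, hq⟩)]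
  split_ifs with hreg
  · refine le_iInf₂ fun p hp => ?_
    rw [← (hreg _ hz).apply_eq hV hz hline hp]
    exact le_iSup₂_of_le (deriv x t) hq le_rfl
  · obtain ⟨p, hp, hpd⟩ := exists_mem_clarkeGradient_eq hV hz hline
    rw [← hpd]
    exact le_iSup₂_of_le p hp (le_iSup₂_of_le (deriv x t) hq le_rfl)

end Inclusion

end ReducedInclusion

end

theorem mainTheorem2 (n : ℕ) (t₀ : ℝ)
    (F : EuclideanSpace ℝ (Fin n) → ℝ → Set (EuclideanSpace ℝ (Fin n)))
    (D : Set (EuclideanSpace ℝ (Fin n))) (hD_open : IsOpen D) (hD_conn : IsConnected D)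
    (b : EReal) (hb : (t₀ : EReal) < b)
    (Ω : Set (EuclideanSpace ℝ (Fin n) × ℝ)) (hΩ : Ω = D ×ˢ ReducedInclusion.rightOpen t₀ b)
    (U : ℕ → EuclideanSpace ℝ (Fin n) × ℝ → ℝ)
    (hU_lip : ∀ i, LocallyLipschitzOn Ω (U i))
    (hU_reg : ∀ i, ReducedInclusion.ClarkeRegularOn Ω (U i))
    (V : EuclideanSpace ℝ (Fin n) × ℝ → ℝ) (hV_lip : LocallyLipschitzOn Ω V)
    (T : EReal) (x : ℝ → EuclideanSpace ℝ (Fin n))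
    (hx : ReducedInclusion.IsMaximalSolution F t₀ T x) (hx₀ : (x t₀, t₀) ∈ Ω) :
    (∀ᵐ t : ℝ,
      t ∈ ReducedInclusion.rightOpen t₀ (ReducedInclusion.exitTime D t₀ T x) ∩
          ReducedInclusion.rightOpen t₀ b →
        DifferentiableAt ℝ (fun s : ℝ => V (x s, s)) t ∧
        deriv (fun s : ℝ => V (x s, s)) t ∈
          Set.image2 (fun p q => p (q, (1 : ℝ)))
            (ReducedInclusion.clarkeGradient Ω V (x t, t))
            (ReducedInclusion.reducedInclusion Ω F U (x t) t)) ∧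
    (∀ W : EuclideanSpace ℝ (Fin n) × ℝ → ℝ,
      (∀ z ∈ Ω, ReducedInclusion.generalizedDeriv Ω F U V z.1 z.2 ≤ ((W z : ℝ) : EReal)) →
      ∀ᵐ t : ℝ,
        t ∈ ReducedInclusion.rightOpen t₀ (ReducedInclusion.exitTime D t₀ T x) ∩
            ReducedInclusion.rightOpen t₀ b →
          DifferentiableAt ℝ (fun s : ℝ => V (x s, s)) t ∧
          deriv (fun s : ℝ => V (x s, s)) t ≤ W (x t, t)) := by 
  have hgood : ∀ᵐ t : ℝ,
      t ∈ ReducedInclusion.rightOpen t₀ (ReducedInclusion.exitTime D t₀ T x) ∩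
          ReducedInclusion.rightOpen t₀ b →
        (x t, t) ∈ interior Ω ∧ DifferentiableAt ℝ x t ∧
        deriv x t ∈ ReducedInclusion.reducedInclusion Ω F U (x t) t ∧
        DifferentiableAt ℝ (fun s : ℝ => V (x s, s)) t := by
    -- Countability of the family `U` keeps the exceptional set null. The time `t₀` is discarded
    -- because `(x t₀, t₀)` is on the boundary of `Ω`.
    filter_upwards [hx.1.inclusion, hx.1.ae_differentiableAt_comp hV_lip,
      ae_all_iff.2 fun i => hx.1.ae_differentiableAt_comp (hU_lip i),
      Measure.ae_ne volume t₀] with t hF hV hU hne ht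
    obtain ⟨hT, hD⟩ := ReducedInclusion.mem_of_lt_exitTime ht.1
    have h0 : t₀ < t := lt_of_le_of_ne ht.2.1 hne.symm
    have hz : (x t, t) ∈ interior Ω :=
      hΩ ▸ ReducedInclusion.mem_interior_prod_rightOpen hD_open hD h0 ht.2.2
    obtain ⟨hdiff, hmem⟩ := hF ⟨h0.le, hT⟩
    exact ⟨hz, hdiff, ReducedInclusion.deriv_mem_reducedInclusion hU_lip hU_reg hz hdiff hmem
      fun i => hU i h0 hT hz, hV h0 hT hz⟩
  refine ⟨?_, fun W hW => ?_⟩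
  · filter_upwards [hgood] with t hgt ht
    obtain ⟨hz, hdiff, hq, hd⟩ := hgt ht
    obtain ⟨p, hp, hpd⟩ := ReducedInclusion.exists_mem_clarkeGradient_eq hV_lip hz
      (ReducedInclusion.hasDerivAt_along_velocity hV_lip hdiff hz hd)
    exact ⟨hd, p, hp, deriv x t, hq, hpd⟩
  · filter_upwards [hgood] with t hgt ht
    obtain ⟨hz, hdiff, hq, hd⟩ := hgt ht
    exact ⟨hd, EReal.coe_le_coe_iff.1
      ((ReducedInclusion.deriv_le_generalizedDeriv hV_lip hz hdiff hq hd).trans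
        (hW _ (interior_subset hz)))⟩
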